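/- Let $G$ be a finitely generated nilpotent group. For a normal subgroup $H$ of finite index in $G$, let $\pi_H:\mathbb{Z}[G]\to\mathbb{Z}[G/H]$ be the ring homomorphism induced by the projection $G\to G/H$. Call a left ideal $I\subset\mathbb{Z}[G]$ \emph{finitely full} if $\pi_H(I)=\mathbb{Z}[G/H]$ for every normal subgroup $H$ of finite index in $G$. Then $\mathbb{Z}[G]$ has \emph{finitely detectable full left ideals}: every finitely full left ideal $I\subset\mathbb{Z}[G]$ is equal to $\mathbb{Z}[G]$. -/

import Mathlib

noncomputable section

/-- The natural projection `ℤ[G] → ℤ[G/H]` of integral group rings, for a normal subgroup `H`. -/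
def groupRingProj {G : Type*} [Group G] (H : Subgroup G) [H.Normal] :
    MonoidAlgebra ℤ G →+* MonoidAlgebra ℤ (G ⧸ H) :=
  MonoidAlgebra.mapDomainRingHom ℤ (QuotientGroup.mk' H)

/-- A left ideal `I` of `ℤ[G]` is finitely full if its image in `ℤ[G/H]` is all of `ℤ[G/H]`
for every normal subgroup `H` of finite index.
(In Mathlib, `Ideal` of a noncommutative ring means left ideal.) -/
def IsFinitelyFull {G : Type*} [Group G] (I : Ideal (MonoidAlgebra ℤ G)) : Prop :=
  ∀ (H : Subgroup G) [H.Normal], H.FiniteIndex →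
    (groupRingProj H) '' (I : Set (MonoidAlgebra ℤ G)) = Set.univ

/-- `ℤ[G]` has finitely detectable full left ideals if every finitely full left ideal
is equal to `ℤ[G]`. -/
def HasFinitelyDetectableFullLeftIdeals (G : Type*) [Group G] : Prop :=
  ∀ I : Ideal (MonoidAlgebra ℤ G), IsFinitelyFull I → I = ⊤

end

/-! A proper left ideal `I` lies in a maximal one `M`, and V = ℤ[G]/M is simple. By an argument of
P. Hall, G acts on V through a finite quotient G/H (`finite_range_toPermHom`). Finite fullness at H
gives a ∈ I with image 1 in ℤ[G/H]. So a acts as the identity on V, yet it kills the class of 1: a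
contradiction.

For finiteness, let a noetherian domain J act on V, commuting with G. If no nonzero element of J
kills V, then by Schur V is torsion-free and divisible over J. But V is cyclic over the J-algebra
generated by G, and a weak form of generic freeness (`isGenericallyNondivisible_adjoin_range`)
forbids divisibility by non-units coprime to some f ≠ 0. Taking J = ℤ yields p with pV = 0; taking J
= 𝔽_p[X], with X acting as a central z, shows that z acts with finite order. A finitely generated
nilpotent group with torsion center is finite. -/

/-! ### Generic nondivisibility and its behaviour along filtrations. -/

section GenericNondivisibility

theorem Submodule.exists_forall_ge_eq_of_monotone {R M : Type*} [Ring R] [AddCommGroup M]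
    [Module R M] {B : Submodule R M} [IsNoetherian R B] {K : ℕ → Submodule R M}
    (hKB : ∀ n, K n ≤ B) (hK : Monotone K) : ∃ N, ∀ n, N ≤ n → K n = K N := by
  obtain ⟨N, hN⟩ := monotone_stabilizes_iff_noetherian.2 ‹IsNoetherian R B›
    ⟨fun n ↦ (K n).comap B.subtype, fun m n hmn ↦ Submodule.comap_mono (hK hmn)⟩
  refine ⟨N, fun n hn ↦ ?_⟩
  have h : (K N).comap B.subtype = (K n).comap B.subtype := hN n hn
  have := congrArg (Submodule.map B.subtype) h
  rwa [Submodule.map_comap_subtype, Submodule.map_comap_subtype, inf_eq_right.2 (hKB _),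
    inf_eq_right.2 (hKB _), eq_comm] at this

/-- The subquotient `B / A` of a `J`-module behaves, away from `f`, like a free module: a non-unit
`q` coprime to `f` acts injectively on it, and surjectively only if `B / A` is `f`-power torsion. -/
def NondivisibleAway {J V : Type*} [CommRing J] [AddCommGroup V] [Module J V]
    (f : J) (A B : Set V) : Prop :=
  ∀ q : J, q ≠ 0 → ¬ IsUnit q → IsCoprime q f →
    (∀ b ∈ B, q • b ∈ A → b ∈ A) ∧
    ((∀ b ∈ B, ∃ c ∈ B, b - q • c ∈ A) → ∀ b ∈ B, ∃ k : ℕ, f ^ k • b ∈ A)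

namespace NondivisibleAway

variable {J V : Type*} [CommRing J] [AddCommGroup V] [Module J V]

theorem refl (f : J) (A : Set V) : NondivisibleAway f A A :=
  fun _ _ _ _ ↦ ⟨fun _ hb _ ↦ hb, fun _ b hb ↦ ⟨0, by simpa using hb⟩⟩

theorem trans {f : J} {A B C : Submodule J V} (hAB : A ≤ B) (hBC : B ≤ C)
    (h₁ : NondivisibleAway f (A : Set V) B) (h₂ : NondivisibleAway f (B : Set V) C) :
    NondivisibleAway f (A : Set V) C := by
  intro q hq hqu hqf
  obtain ⟨h₁a, h₁b⟩ := h₁ q hq hqu hqf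
  obtain ⟨h₂a, h₂b⟩ := h₂ q hq hqu hqf
  refine ⟨fun c hc hqc ↦ ?_, fun H c hc ↦ ?_⟩
  · exact h₁a c (h₂a c hc (hAB hqc)) hqc
  · obtain ⟨k, hk⟩ := h₂b (fun b hb ↦ (H b hb).imp fun c hc ↦ ⟨hc.1, hAB hc.2⟩) c hc
    obtain ⟨l, hl⟩ := h₁b (fun b hb ↦ by
      obtain ⟨d, hd, hbd⟩ := H b (hBC hb)
      -- The quotient d is only known to lie in C; injectivity of q on C / B pulls it back into B.
      refine ⟨d, h₂a d hd ?_, hbd⟩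
      have := B.sub_mem hb (hAB hbd)
      simpa using this) _ hk
    exact ⟨l + k, by rwa [pow_add, mul_smul]⟩

theorem mul_right {f : J} {A : Submodule J V} {B : Set V}
    (h : NondivisibleAway f (A : Set V) B) (g : J) : NondivisibleAway (f * g) (A : Set V) B := by
  intro q hq hqu hqf
  obtain ⟨ha, hb⟩ := h q hq hqu hqf.of_mul_right_left
  refine ⟨ha, fun H b hbB ↦ (hb H b hbB).imp fun k hk ↦ ?_⟩
  rw [mul_pow, mul_comm, mul_smul]
  exact A.smul_mem _ hk

theorem of_dvd {f g : J} (hfg : f ∣ g) {A : Submodule J V} {B : Set V}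
    (h : NondivisibleAway f (A : Set V) B) : NondivisibleAway g (A : Set V) B := by
  obtain ⟨c, rfl⟩ := hfg
  exact h.mul_right c

theorem iUnion {f : J} {M : ℕ → Submodule J V} (hM : Monotone M)
    (h : ∀ n, NondivisibleAway f (M n : Set V) (M (n + 1))) :
    NondivisibleAway f (M 0 : Set V) (⋃ n, (M n : Set V)) := by
  have hle : ∀ m k, NondivisibleAway f (M m : Set V) (M (m + k)) := by
    intro m k
    induction k with
    | zero => exact refl f _
    | succ k ih => exact ih.trans (hM (by omega)) (hM (by omega)) (h _)
  intro q hq hqu hqf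
  refine ⟨fun b hb hqb ↦ ?_, fun H b hb ↦ ?_⟩
  · obtain ⟨n, hn⟩ := Set.mem_iUnion.1 hb
    exact (hle 0 n q hq hqu hqf).1 b (by simpa using hn) hqb
  · obtain ⟨n, hn⟩ := Set.mem_iUnion.1 hb
    refine (hle 0 n q hq hqu hqf).2 (fun b hb ↦ ?_) b (by simpa using hn)
    rw [zero_add] at hb
    obtain ⟨c, hc, hbc⟩ := H b (Set.mem_iUnion.2 ⟨n, hb⟩)
    obtain ⟨m, hm⟩ := Set.mem_iUnion.1 hc
    refine ⟨c, ?_, hbc⟩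
    rw [zero_add]
    refine (hle n m q hq hqu hqf).1 c (hM (Nat.le_add_left m n) hm) ?_
    have := (M n).sub_mem hb (hM (Nat.zero_le n) hbc)
    simpa using this

/-- Take f killing the torsion of B / A, which is finitely generated. If q is surjective on B / A,
Nakayama gives r ≡ 1 mod q killing B / A; r ≠ 0 because q is not a unit, so B / A is torsion and f
kills it. -/
theorem exists_of_fg [IsDomain J] [IsNoetherianRing J] {A B : Submodule J V} (hB : B.FG) :
    ∃ f : J, f ≠ 0 ∧ NondivisibleAway f (A : Set V) B := by
  set B' := B.map A.mkQ with hB'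
  have hB'fg : B'.FG := hB.map _
  have : IsNoetherian J B' := isNoetherian_of_fg_of_noetherian _ hB'fg
  set T := B' ⊓ Submodule.torsion J (V ⧸ A) with hT
  have hTfg : T.FG := isNoetherian_submodule.1 this T inf_le_left
  have key : ∃ f : J, f ≠ 0 ∧ ∀ t ∈ T, f • t = 0 := by
    obtain ⟨s, hs⟩ := hTfg
    have hs' : ∀ t ∈ s, ∃ f : J, f ≠ 0 ∧ f • t = 0 := fun t ht ↦ by
      have : t ∈ T := hs ▸ Submodule.subset_span ht
      obtain ⟨a, ha⟩ := (Submodule.mem_torsion_iff t).1 this.2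
      exact ⟨a, nonZeroDivisors.coe_ne_zero a, ha⟩
    choose! g hg0 hg using hs'
    refine ⟨∏ t ∈ s, g t, Finset.prod_ne_zero_iff.2 hg0, fun t ht ↦ ?_⟩
    rw [← hs] at ht
    induction ht using Submodule.span_induction with
    | mem t ht =>
      obtain ⟨c, hc⟩ := Finset.dvd_prod_of_mem g ht
      rw [hc, mul_comm, mul_smul, hg t ht, smul_zero]
    | zero => simp
    | add x y _ _ hx hy => rw [smul_add, hx, hy, add_zero]
    | smul a x _ hx => rw [smul_comm, hx, smul_zero]
  obtain ⟨f, hf0, hf⟩ := key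
  have hA : ∀ v, A.mkQ v = 0 ↔ v ∈ A := fun v ↦ Submodule.Quotient.mk_eq_zero A
  have hf' : ∀ b ∈ B, ∀ r : J, r ≠ 0 → r • b ∈ A → f • b ∈ A := by
    intro b hb r hr hrb
    have : f • A.mkQ b = 0 := by
      refine hf _ ⟨Submodule.mem_map_of_mem hb, (Submodule.mem_torsion_iff _).2
        ⟨⟨r, mem_nonZeroDivisors_of_ne_zero hr⟩, ?_⟩⟩
      change r • A.mkQ b = 0
      rwa [← map_smul, hA]
    rwa [← map_smul, hA] at this
  refine ⟨f, hf0, fun q hq hqu hqf ↦ ⟨fun b hb hqb ↦ ?_, fun H b hb ↦ ⟨1, ?_⟩⟩⟩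
  · obtain ⟨u, v, huv⟩ := hqf
    have h1 := A.add_mem (A.smul_mem u hqb) (A.smul_mem v (hf' b hb q hq hqb))
    rwa [← mul_smul, ← mul_smul, ← add_smul, huv, one_smul] at h1
  · obtain ⟨r, hr1, hr⟩ := Submodule.exists_sub_one_mem_and_smul_eq_zero_of_fg_of_le_smul
      (Ideal.span {q}) B' hB'fg (by
        rintro _ ⟨b, hb, rfl⟩
        obtain ⟨c, hc, hbc⟩ := H b hb
        have : A.mkQ b = q • A.mkQ c := by
          rwa [← map_smul, ← sub_eq_zero, ← map_sub, hA]
        rw [this]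
        exact Submodule.smul_mem_smul (Ideal.mem_span_singleton_self q)
          (Submodule.mem_map_of_mem hc))
    rw [pow_one]
    refine hf' b hb r ?_ ?_
    · rintro rfl
      refine hqu (isUnit_iff_dvd_one.2 ?_)
      simpa [Ideal.mem_span_singleton] using hr1
    · have := hr _ (Submodule.mem_map_of_mem hb)
      rwa [← map_smul, hA] at this

end NondivisibleAway

variable {J E V : Type*} [CommRing J] [Ring E] [Algebra J E] [AddCommGroup V] [Module E V]

/-- Restriction of a submodule to a smaller subalgebra. -/
def Submodule.restrictSubalgebra {R S : Subalgebra J E} (h : R ≤ S) (A : Submodule S V) :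
    Submodule R V where
  toAddSubmonoid := A.toAddSubmonoid
  smul_mem' c _ hx := A.smul_mem (⟨c, h c.2⟩ : S) hx

/-- `x R = R x`. -/
structure Subalgebra.NormalizedBy (R : Subalgebra J E) (x : E) : Prop where
  mul_left : ∀ r ∈ R, ∃ s ∈ R, x * r = s * x
  mul_right : ∀ r ∈ R, ∃ s ∈ R, r * x = x * s

theorem Subalgebra.NormalizedBy.pow {R : Subalgebra J E} {x : E} (h : R.NormalizedBy x) (n : ℕ) :
    R.NormalizedBy (x ^ n) := by
  induction n with
  | zero => exact ⟨fun r hr ↦ ⟨r, hr, by simp⟩, fun r hr ↦ ⟨r, hr, by simp⟩⟩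
  | succ n ih =>
    refine ⟨fun r hr ↦ ?_, fun r hr ↦ ?_⟩
    · obtain ⟨s, hs, e⟩ := h.mul_left r hr
      obtain ⟨t, ht, e'⟩ := ih.mul_left s hs
      exact ⟨t, ht, by rw [pow_succ, mul_assoc, e, ← mul_assoc, e', mul_assoc]⟩
    · obtain ⟨s, hs, e⟩ := ih.mul_right r hr
      obtain ⟨t, ht, e'⟩ := h.mul_right s hs
      exact ⟨t, ht, by rw [pow_succ, ← mul_assoc, e, mul_assoc, e', mul_assoc]⟩

section Filtration

variable {R : Subalgebra J E} {x : E}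

/-- The image of an `R`-submodule under a normalizing element. -/
def Submodule.normalMap (h : R.NormalizedBy x) (B : Submodule R V) : Submodule R V where
  carrier := (x • ·) '' (B : Set V)
  add_mem' := by
    rintro _ _ ⟨a, ha, rfl⟩ ⟨b, hb, rfl⟩
    exact ⟨a + b, add_mem ha hb, smul_add _ _ _⟩
  zero_mem' := ⟨0, zero_mem _, smul_zero _⟩
  smul_mem' := by
    rintro ⟨r, hr⟩ _ ⟨a, ha, rfl⟩
    obtain ⟨s, hs, e⟩ := h.mul_right r hr
    refine ⟨(⟨s, hs⟩ : R) • a, B.smul_mem _ ha, ?_⟩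
    simp only [Subalgebra.smul_def, ← mul_smul, e]

/-- The elements of `B` mapped into `A` by a normalizing element. -/
def Submodule.normalComap (h : R.NormalizedBy x) (B A : Submodule R V) : Submodule R V where
  carrier := {b | b ∈ B ∧ x • b ∈ A}
  add_mem' ha hb := ⟨add_mem ha.1 hb.1, by rw [smul_add]; exact add_mem ha.2 hb.2⟩
  zero_mem' := ⟨zero_mem _, by rw [smul_zero]; exact zero_mem _⟩
  smul_mem' := by
    rintro ⟨r, hr⟩ a ⟨ha, ha'⟩
    obtain ⟨s, hs, e⟩ := h.mul_left r hr
    refine ⟨B.smul_mem _ ha, ?_⟩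
    have := A.smul_mem (⟨s, hs⟩ : R) ha'
    rwa [Subalgebra.smul_def, ← mul_smul, ← e, mul_smul] at this

theorem Submodule.mem_normalComap {h : R.NormalizedBy x} {B A : Submodule R V} {b : V} :
    b ∈ Submodule.normalComap h B A ↔ b ∈ B ∧ x • b ∈ A := Iff.rfl

/-- The filtration `A ≤ A + B ≤ A + B + x B ≤ ⋯`. -/
def Submodule.normalFiltration (h : R.NormalizedBy x) (A B : Submodule R V) : ℕ → Submodule R V
  | 0 => A
  | n + 1 => Submodule.normalFiltration h A B n ⊔ Submodule.normalMap (h.pow n) B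

namespace Submodule

variable (h : R.NormalizedBy x) (A B : Submodule R V)

theorem mem_normalFiltration_succ {n : ℕ} {v : V} : v ∈ normalFiltration h A B (n + 1) ↔
    ∃ a ∈ normalFiltration h A B n, ∃ b ∈ B, a + x ^ n • b = v := by
  rw [normalFiltration, Submodule.mem_sup]
  refine exists_congr fun a ↦ and_congr_right fun _ ↦ ?_
  constructor
  · rintro ⟨_, ⟨b, hb, rfl⟩, e⟩
    exact ⟨b, hb, e⟩
  · rintro ⟨b, hb, e⟩
    exact ⟨_, ⟨b, hb, rfl⟩, e⟩

theorem normalFiltration_mono : Monotone (normalFiltration h A B) :=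
  monotone_nat_of_le_succ fun _ ↦ le_sup_left

variable {A} in
theorem smul_mem_normalFiltration (hA : ∀ a ∈ A, x • a ∈ A) (n : ℕ) {v : V}
    (hv : v ∈ normalFiltration h A B n) : x • v ∈ normalFiltration h A B (n + 1) := by
  induction n generalizing v with
  | zero => exact normalFiltration_mono h A B (Nat.zero_le 1) (hA v hv)
  | succ n ih =>
    obtain ⟨a, ha, b, hb, rfl⟩ := (mem_normalFiltration_succ h A B).1 hv
    refine (mem_normalFiltration_succ h A B).2 ⟨_, ih ha, b, hb, ?_⟩
    rw [smul_add, ← mul_smul, pow_succ']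

variable {A} in
theorem normalComap_mono (hA : ∀ a ∈ A, x • a ∈ A) :
    Monotone fun n ↦ normalComap (h.pow n) B (normalFiltration h A B n) := by
  refine monotone_nat_of_le_succ fun n b hb ↦ ⟨hb.1, ?_⟩
  rw [pow_succ', mul_smul]
  exact smul_mem_normalFiltration h B hA n hb.2

end Submodule

end Filtration

variable [Module J V] [IsScalarTower J E V]

/-- The submodule over the base ring underlying a submodule over a subalgebra. -/
def Submodule.toBase {R : Subalgebra J E} (A : Submodule R V) : Submodule J V where
  toAddSubmonoid := A.toAddSubmonoid
  smul_mem' c x hx := by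
    have := A.smul_mem (algebraMap J R c) hx
    rwa [Subalgebra.smul_def, Subalgebra.coe_algebraMap, algebraMap_smul] at this

theorem Submodule.mem_toBase {R : Subalgebra J E} {A : Submodule R V} {v : V} :
    v ∈ A.toBase ↔ v ∈ A := Iff.rfl

variable (V) in
/-- Finitely generated `R`-submodules of `V` are noetherian and all their quotients are
nondivisible away from some nonzero `f : J`. -/
def IsGenericallyNondivisible (R : Subalgebra J E) : Prop :=
  ∀ B : Submodule R V, B.FG → IsNoetherian R B ∧
    ∀ A ≤ B, ∃ f : J, f ≠ 0 ∧ NondivisibleAway f (A : Set V) B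

theorem isGenericallyNondivisible_bot [IsDomain J] [IsNoetherianRing J] :
    IsGenericallyNondivisible V (⊥ : Subalgebra J E) := by
  have hsurj : Function.Surjective (algebraMap J (⊥ : Subalgebra J E)) := by
    rintro ⟨x, hx⟩
    obtain ⟨c, rfl⟩ := Algebra.mem_bot.1 hx
    exact ⟨c, rfl⟩
  have : IsNoetherianRing (⊥ : Subalgebra J E) := isNoetherianRing_of_surjective _ _ _ hsurj
  refine fun B hB ↦ ⟨isNoetherian_of_fg_of_noetherian _ hB, fun A _ ↦ ?_⟩
  obtain ⟨s, hs⟩ := hB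
  have hfg : B.toBase.FG := by
    refine ⟨s, le_antisymm (Submodule.span_le.2 fun x hx ↦ ?_) fun x hx ↦ ?_⟩
    · exact hs ▸ Submodule.subset_span hx
    · rw [Submodule.mem_toBase, ← hs] at hx
      induction hx using Submodule.span_induction with
      | mem x hx => exact Submodule.subset_span hx
      | zero => exact zero_mem _
      | add x y _ _ hx hy => exact add_mem hx hy
      | smul a x _ hx =>
        obtain ⟨c, rfl⟩ := hsurj a
        rw [Subalgebra.smul_def, Subalgebra.coe_algebraMap, algebraMap_smul]
        exact Submodule.smul_mem _ _ hx
  exact NondivisibleAway.exists_of_fg (A := A.toBase) hfg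

/-- The n-th quotient of the filtration is B / K n, via b ↦ x ^ n • b. The K n increase and B is
noetherian, so only finitely many quotients occur, and the product of their f's serves all of them.
-/
theorem Submodule.exists_nondivisibleAway_normalFiltration {R : Subalgebra J E} {x : E}
    (h : R.NormalizedBy x) (A B : Submodule R V) [IsNoetherian R B] [IsDomain J]
    (hA : ∀ a ∈ A, x • a ∈ A)
    (hB : ∀ K ≤ B, ∃ f : J, f ≠ 0 ∧ NondivisibleAway f (K : Set V) B) :
    ∃ f : J, f ≠ 0 ∧ NondivisibleAway f (A : Set V) (⋃ n, (normalFiltration h A B n : Set V)) := by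
  set K := fun n ↦ normalComap (h.pow n) B (normalFiltration h A B n) with hK
  have hKB : ∀ n, K n ≤ B := fun n b hb ↦ hb.1
  have hmono : Monotone K := normalComap_mono h B hA
  obtain ⟨N, hN'⟩ := Submodule.exists_forall_ge_eq_of_monotone hKB hmono
  choose f hf0 hf using fun n ↦ hB (K n) (hKB n)
  set F := ∏ n ∈ Finset.range (N + 1), f n with hF
  have hFK : ∀ n, NondivisibleAway F (K n : Set V) B := by
    have : ∀ n ≤ N, NondivisibleAway F (K n : Set V) B := fun n hn ↦
      (hf n).of_dvd (A := (K n).toBase)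
        (Finset.dvd_prod_of_mem f (Finset.mem_range.2 (Nat.lt_succ_of_le hn)))
    intro n
    rcases le_total n N with hn | hn
    · exact this n hn
    · rw [hN' n hn]
      exact this N le_rfl
  refine ⟨F, Finset.prod_ne_zero_iff.2 fun n _ ↦ hf0 n, ?_⟩
  refine NondivisibleAway.iUnion (M := fun n ↦ (normalFiltration h A B n).toBase)
    (fun m n hmn ↦ normalFiltration_mono h A B hmn) fun n q hq hqu hqF ↦ ?_
  obtain ⟨ha, hb⟩ := hFK n q hq hqu hqF
  have hcomm : ∀ (c : J) (m : V), c • x ^ n • m = x ^ n • c • m := fun c m ↦ by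
    rw [← algebraMap_smul E c m, ← algebraMap_smul E c (x ^ n • m), ← mul_smul, ← mul_smul,
      Algebra.commutes]
  set M := (normalFiltration h A B n).toBase with hM
  have hmem : ∀ {a m : V}, a ∈ M → m ∈ B → ∀ c : J, (c • (a + x ^ n • m) ∈ M ↔ c • m ∈ K n) := by
    intro a m ha hm c
    rw [smul_add, M.add_mem_iff_right (M.smul_mem c ha), hcomm, hK, mem_normalComap]
    exact ⟨fun H ↦ ⟨B.toBase.smul_mem c hm, H⟩, fun H ↦ H.2⟩
  refine ⟨fun b hbM hqb ↦ ?_, fun H b hbM ↦ ?_⟩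
  · obtain ⟨a, haM, m, hm, rfl⟩ := (mem_normalFiltration_succ h A B).1 hbM
    have h1 := ha m hm ((hmem haM hm q).1 hqb)
    exact M.add_mem haM h1.2
  · obtain ⟨a, haM, m, hm, rfl⟩ := (mem_normalFiltration_succ h A B).1 hbM
    obtain ⟨k, hk⟩ := hb (fun m hm ↦ by
      obtain ⟨c, hc, hmc⟩ := H (x ^ n • m)
        ((mem_normalFiltration_succ h A B).2 ⟨0, zero_mem _, m, hm, zero_add _⟩)
      obtain ⟨a, ha, d, hd, rfl⟩ := (mem_normalFiltration_succ h A B).1 hc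
      refine ⟨d, hd, sub_mem hm (B.toBase.smul_mem q hd), ?_⟩
      have := M.add_mem hmc (M.smul_mem q ha)
      rw [smul_add, hcomm] at this
      have e : x ^ n • (m - q • d) = x ^ n • m - (q • a + x ^ n • q • d) + q • a := by
        rw [smul_sub]
        abel
      rwa [← e] at this) m hm
    exact ⟨k, (hmem haM hm _).2 hk⟩

end GenericNondivisibility

/-! ### Adjoining a normalizing element to the ring of operators. -/

section NormalExtension

namespace Submodule

variable {J E V : Type*} [CommRing J] [Ring E] [Algebra J E] [AddCommGroup V] [Module E V]
  {R S : Subalgebra J E} {x : E} (h : R.NormalizedBy x)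

theorem normalFiltration_mono_left {A A' : Submodule R V} (hA : A ≤ A') (B : Submodule R V)
    (n : ℕ) : normalFiltration h A B n ≤ normalFiltration h A' B n := by
  induction n with
  | zero => exact hA
  | succ n ih => exact sup_le_sup_right ih _

theorem normalFiltration_le {A B C : Submodule R V} (hA : A ≤ C) (hB : B ≤ C)
    (hC : ∀ c ∈ C, x • c ∈ C) (n : ℕ) : normalFiltration h A B n ≤ C := by
  induction n with
  | zero => exact hA
  | succ n ih =>
    refine sup_le ih ?_
    rintro _ ⟨b, hb, rfl⟩
    have : ∀ k : ℕ, x ^ k • b ∈ C := fun k ↦ by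
      induction k with
      | zero => simpa using hB hb
      | succ k ihk => rw [pow_succ', mul_smul]; exact hC _ ihk
    exact this n

theorem exists_sub_mem_normalFiltration_bot {A B : Submodule R V} {n : ℕ} {v : V}
    (hv : v ∈ normalFiltration h A B n) : ∃ a ∈ A, v - a ∈ normalFiltration h ⊥ B n := by
  induction n generalizing v with
  | zero => exact ⟨v, hv, by rw [sub_self]; exact zero_mem _⟩
  | succ n ih =>
    obtain ⟨w, hw, b, hb, rfl⟩ := (mem_normalFiltration_succ h A B).1 hv
    obtain ⟨a, ha, hwa⟩ := ih hw
    exact ⟨a, ha, (mem_normalFiltration_succ h ⊥ B).2 ⟨_, hwa, b, hb, by abel⟩⟩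

theorem exists_mem_normalFiltration {x : E} (h : R.NormalizedBy x) {A B : Submodule R V}
    (hA : ∀ a ∈ A, x • a ∈ A)
    {s : E} (hs : s ∈ Algebra.adjoin J (insert x (R : Set E))) {v : V}
    (hv : ∃ n, v ∈ normalFiltration h A B n) : ∃ n, s • v ∈ normalFiltration h A B n := by
  have hR : ∀ r ∈ R, ∀ v, (∃ n, v ∈ normalFiltration h A B n) →
      ∃ n, r • v ∈ normalFiltration h A B n :=
    fun r hr v hv ↦ hv.imp fun n hn ↦ smul_mem _ (⟨r, hr⟩ : R) hn
  induction hs using Algebra.adjoin_induction generalizing v with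
  | mem s hs =>
    rcases hs with rfl | hs
    · obtain ⟨n, hn⟩ := hv
      exact ⟨n + 1, smul_mem_normalFiltration h B hA n hn⟩
    · exact hR s hs v hv
  | algebraMap c => exact hR _ (R.algebraMap_mem c) v hv
  | add s t _ _ hs ht =>
    obtain ⟨m, hm⟩ := hs hv
    obtain ⟨n, hn⟩ := ht hv
    refine ⟨max m n, ?_⟩
    rw [add_smul]
    exact add_mem (normalFiltration_mono h A B (le_max_left m n) hm)
      (normalFiltration_mono h A B (le_max_right m n) hn)
  | mul s t _ _ hs ht => rw [mul_smul]; exact hs (ht hv)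

/-- Descent on the degree in x: the leading coefficient b of an element of A is also one for A', so
its top term can be absorbed into lower degree. -/
theorem le_of_normalComap_le {A A' B : Submodule R V} (hle : A' ≤ A)
    (hK : ∀ n, normalComap (h.pow n) B (normalFiltration h A B n) ≤
      normalComap (h.pow n) B (normalFiltration h A' B n))
    (hA : ∀ a ∈ A, ∃ n, a ∈ normalFiltration h A' B n) : A ≤ A' := by
  have key : ∀ n, ∀ v ∈ A, v ∈ normalFiltration h A' B n → v ∈ A' := by
    intro n
    induction n with
    | zero => exact fun v _ hv ↦ hv
    | succ n ih =>
      intro v hvA hv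
      obtain ⟨a, ha, b, hb, rfl⟩ := (mem_normalFiltration_succ h A' B).1 hv
      refine ih _ hvA (add_mem ha (hK n ⟨hb, ?_⟩).2)
      have := sub_mem (normalFiltration_mono h A B (Nat.zero_le n) hvA)
        (normalFiltration_mono_left h hle B n ha)
      rwa [add_sub_cancel_left] at this
  exact fun a ha ↦ (hA a ha).elim fun n hn ↦ key n a ha hn

/-- Hilbert's basis theorem: the K N n are the modules of leading coefficients of N. They stabilize
at m, and lifts `ν n b` = x ^ n • b + lower terms, for generators b of K N n with n ≤ m, generate N.
-/
theorem isNoetherian_of_normalFiltration (hRS : R ≤ S) (hx : x ∈ S) {B : Submodule S V}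
    {B₀ : Submodule R V} [IsNoetherian R B₀]
    (hB : ∀ b ∈ B, ∃ n, b ∈ normalFiltration h ⊥ B₀ n) : IsNoetherian S B := by
  refine isNoetherian_submodule.2 fun N hN ↦ ?_
  have hstab : ∀ (A : Submodule S V), ∀ a ∈ A.restrictSubalgebra hRS,
      x • a ∈ A.restrictSubalgebra hRS := fun A a ha ↦ A.smul_mem (⟨x, hx⟩ : S) ha
  set K : Submodule S V → ℕ → Submodule R V := fun A n ↦
    normalComap (h.pow n) B₀ (normalFiltration h (A.restrictSubalgebra hRS) B₀ n) with hK
  have hKB : ∀ A n, K A n ≤ B₀ := fun A n b hb ↦ hb.1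
  have hmono : ∀ A, Monotone (K A) := fun A ↦ normalComap_mono h B₀ (hstab A)
  obtain ⟨m, hm'⟩ := exists_forall_ge_eq_of_monotone (hKB N) (hmono N)
  choose s hs using fun n ↦ isNoetherian_submodule.1 ‹IsNoetherian R B₀› (K N n) (hKB N n)
  have hν : ∀ n, ∀ b ∈ s n, ∃ a ∈ N, x ^ n • b - a ∈ normalFiltration h ⊥ B₀ n := fun n b hb ↦ by
    have hb' : b ∈ K N n := by rw [← hs n]; exact subset_span hb
    exact exists_sub_mem_normalFiltration_bot h hb'.2
  choose! ν hνN hν using hν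
  set T : Set V := ⋃ n ∈ Finset.range (m + 1), ν n '' s n with hT
  have hTfin : T.Finite :=
    Set.Finite.biUnion (Finset.finite_toSet _) fun n _ ↦ (Finset.finite_toSet _).image _
  have hTN : span S T ≤ N := by
    refine span_le.2 (Set.iUnion₂_subset fun n _ ↦ ?_)
    rintro _ ⟨b, hb, rfl⟩
    exact hνN n b hb
  refine (le_antisymm hTN ?_ : span S T = N) ▸ fg_span hTfin
  have hKle : ∀ n ≤ m, K N n ≤ K (span S T) n := by
    intro n hn
    rw [← hs n, span_le]
    intro b hb
    have hb' : b ∈ K N n := by rw [← hs n]; exact subset_span hb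
    refine ⟨hb'.1, ?_⟩
    have h1 := normalFiltration_mono_left h (bot_le : ⊥ ≤ (span S T).restrictSubalgebra hRS) B₀ n
      (hν n b hb)
    have h2 : ν n b ∈ (span S T).restrictSubalgebra hRS := subset_span
      (Set.mem_biUnion (Finset.mem_coe.2 (Finset.mem_range.2 (Nat.lt_succ_of_le hn)))
        ⟨b, hb, rfl⟩)
    have := add_mem h1 (normalFiltration_mono h _ B₀ (Nat.zero_le n) h2)
    rwa [sub_add_cancel] at this
  refine le_of_normalComap_le (A := N.restrictSubalgebra hRS)
    (A' := (span S T).restrictSubalgebra hRS) (B := B₀) h hTN (fun n ↦ ?_) fun a ha ↦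
      (hB a (hN ha)).imp fun n hn ↦ normalFiltration_mono_left h bot_le B₀ n hn
  change K N n ≤ K (span S T) n
  rcases le_total n m with hn | hn
  · exact hKle n hn
  · rw [hm' n hn]
    exact (hKle m le_rfl).trans (hmono _ hn)

end Submodule

variable {J E V : Type*} [CommRing J] [IsDomain J] [Ring E] [Algebra J E] [AddCommGroup V]
  [Module J V] [Module E V] [IsScalarTower J E V]

/-- The generators of B span B₀ over R, and the filtration built from B₀ exhausts B, so both
properties pass from B₀ to B. -/
theorem IsGenericallyNondivisible.adjoin_insert {R : Subalgebra J E}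
    (hR : IsGenericallyNondivisible V R) {x : E} (h : R.NormalizedBy x) :
    IsGenericallyNondivisible V (Algebra.adjoin J (insert x (R : Set E))) := by
  set S := Algebra.adjoin J (insert x (R : Set E)) with hS
  have hxS : x ∈ S := Algebra.subset_adjoin (Set.mem_insert _ _)
  have hRS : R ≤ S := fun r hr ↦ Algebra.subset_adjoin (Set.mem_insert_of_mem _ hr)
  rintro B ⟨T, hT⟩
  set B₀ : Submodule R V := Submodule.span R (T : Set V) with hB₀
  obtain ⟨hnoeth, hB₀⟩ := hR B₀ ⟨T, rfl⟩
  have hex : ∀ A : Submodule R V, (∀ a ∈ A, x • a ∈ A) →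
      ∀ b ∈ B, ∃ n, b ∈ Submodule.normalFiltration h A B₀ n := by
    intro A hA b hb
    rw [← hT] at hb
    induction hb using Submodule.span_induction with
    | mem b hb =>
      exact ⟨1, (Submodule.mem_normalFiltration_succ h A B₀).2
        ⟨0, zero_mem _, b, Submodule.subset_span hb, by simp⟩⟩
    | zero => exact ⟨0, zero_mem _⟩
    | add b c _ _ hb hc =>
      obtain ⟨m, hm⟩ := hb
      obtain ⟨n, hn⟩ := hc
      exact ⟨max m n, add_mem (Submodule.normalFiltration_mono h A B₀ (le_max_left m n) hm)
        (Submodule.normalFiltration_mono h A B₀ (le_max_right m n) hn)⟩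
    | smul s b _ hb => exact Submodule.exists_mem_normalFiltration h hA s.2 hb
  refine ⟨Submodule.isNoetherian_of_normalFiltration h hRS hxS (hex ⊥ ?_), fun A hAB ↦ ?_⟩
  · intro a ha
    rw [(Submodule.mem_bot R).1 ha, smul_zero]
    exact zero_mem _
  have hstab : ∀ (C : Submodule S V), ∀ a ∈ C.restrictSubalgebra hRS,
      x • a ∈ C.restrictSubalgebra hRS := fun C a ha ↦ C.smul_mem (⟨x, hxS⟩ : S) ha
  obtain ⟨f, hf0, hf⟩ := Submodule.exists_nondivisibleAway_normalFiltration h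
    (A.restrictSubalgebra hRS) B₀ (hstab A) hB₀
  refine ⟨f, hf0, ?_⟩
  have hB₀B : B₀ ≤ B.restrictSubalgebra hRS := by
    refine Submodule.span_le.2 fun b hb ↦ ?_
    change b ∈ B
    exact hT ▸ Submodule.subset_span hb
  have hU : (B : Set V) =
      ⋃ n, (Submodule.normalFiltration h (A.restrictSubalgebra hRS) B₀ n : Set V) := ?_
  · rw [hU]
    exact hf
  refine Set.Subset.antisymm (fun b hb ↦ ?_) (Set.iUnion_subset fun n ↦ ?_)
  · exact Set.mem_iUnion.2 (hex _ (hstab A) b hb)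
  · exact Submodule.normalFiltration_le h (C := B.restrictSubalgebra hRS) hAB hB₀B (hstab B) n

end NormalExtension

/-! ### Finitely generated nilpotent groups. -/

section NilpotentGroups

open scoped commutatorElement

theorem Subgroup.closure_normal_of_commutator_mem {G : Type*} [Group G] {X T : Set G}
    (hX : Subgroup.closure X = ⊤) (hinv : ∀ x ∈ X, x⁻¹ ∈ X)
    (h : ∀ t ∈ T, ∀ x ∈ X, ⁅t, x⁆ ∈ Subgroup.closure T) : (Subgroup.closure T).Normal := by
  have hconj : ∀ x ∈ X, ∀ g ∈ Subgroup.closure T, x * g * x⁻¹ ∈ Subgroup.closure T := by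
    intro x hx g hg
    induction hg using Subgroup.closure_induction with
    | mem t ht =>
      have := mul_mem (inv_mem (h t ht x hx)) (Subgroup.subset_closure ht)
      simpa [commutatorElement_def, mul_assoc] using this
    | one => simp
    | mul a b _ _ ha hb => simpa [mul_assoc] using mul_mem ha hb
    | inv a _ ha => simpa [mul_assoc] using inv_mem ha
  refine ⟨fun n hn g ↦ ?_⟩
  have hg : g ∈ Subgroup.closure X := hX ▸ Subgroup.mem_top g
  induction hg using Subgroup.closure_induction_left generalizing n with
  | one => simpa using hn
  | mul_left x hx y _ ih => simpa [mul_assoc] using hconj x hx _ (ih n hn)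
  | inv_mul_cancel x hx y _ ih => simpa [mul_assoc] using hconj _ (hinv x hx) _ (ih n hn)

/-- A finitely generated nilpotent group is obtained from the trivial subgroup by successively
adjoining single elements to normal subgroups. -/
theorem Group.fg_nilpotent_induction {G : Type*} [Group G] [Group.FG G] [Group.IsNilpotent G]
    {P : Subgroup G → Prop} (bot : P ⊥)
    (sup_zpowers : ∀ (H : Subgroup G) [H.Normal] (g : G), P H → P (H ⊔ Subgroup.zpowers g)) :
    P ⊤ := by
  obtain ⟨S, hS, hSfin⟩ := Group.fg_iff.1 ‹Group.FG G›
  set X : Set G := S ∪ S⁻¹ with hXdef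
  have hXfin : X.Finite := hSfin.union hSfin.inv
  have hX : Subgroup.closure X = ⊤ := top_le_iff.1 (hS ▸ Subgroup.closure_mono Set.subset_union_left)
  have hinv : ∀ x ∈ X, x⁻¹ ∈ X := by
    rintro x (hx | hx)
    · exact Or.inr (by simpa using hx)
    · exact Or.inl hx
  -- C n consists of the left-normed commutators of weight n + 1 in X, and D n below of those of
  -- weight greater than n.
  let C : ℕ → Set G := fun n ↦ n.rec X fun _ A ↦ Set.image2 (fun a x ↦ ⁅a, x⁆) A X
  have hC : ∀ n, ∀ a ∈ C n, ∀ x ∈ X, ⁅a, x⁆ ∈ C (n + 1) := fun n a ha x hx ↦ ⟨a, ha, x, hx, rfl⟩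
  have hCfin : ∀ n, (C n).Finite := fun n ↦ by
    induction n with
    | zero => exact hXfin
    | succ n ih => exact ih.image2 _ hXfin
  have hClcs : ∀ n, C n ⊆ (⊤ : Subgroup G).lowerCentralSeries n := fun n ↦ by
    induction n with
    | zero => exact fun _ _ ↦ Subgroup.mem_top _
    | succ n ih =>
      rintro _ ⟨a, ha, x, -, rfl⟩
      exact Subgroup.commutator_mem_commutator (ih ha) (Subgroup.mem_top x)
  let D : ℕ → Set G := fun n ↦ ⋃ j ≥ n, C j
  have hCD : ∀ n j, n ≤ j → C j ⊆ D n := fun n j hnj ↦ Set.subset_biUnion_of_mem (u := C) hnj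
  have hD : ∀ n, C n ∪ D (n + 1) = D n := fun n ↦ by
    refine Set.Subset.antisymm (Set.union_subset (hCD n n le_rfl)
      (Set.iUnion₂_subset fun j hj ↦ hCD n j (Nat.le_of_succ_le hj))) ?_
    refine Set.iUnion₂_subset fun j hj ↦ ?_
    rcases Nat.eq_or_lt_of_le hj with rfl | hj
    · exact Set.subset_union_left
    · exact (hCD (n + 1) j hj).trans Set.subset_union_right
  have hstep : ∀ n, P (Subgroup.closure (D (n + 1))) → P (Subgroup.closure (D n)) := by
    intro n hn
    rw [← hD n]
    refine Set.Finite.induction_on_subset (motive := fun F _ ↦ P (Subgroup.closure (F ∪ D (n + 1))))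
      (C n) (hCfin n) ?_ ?_
    · simpa using hn
    · intro a F _ hF _ ih
      -- Commutators with X raise the weight, hence land in D (n + 1), so elements of C n can be
      -- adjoined one by one in any order.
      have hnormal : (Subgroup.closure (F ∪ D (n + 1))).Normal := by
        refine Subgroup.closure_normal_of_commutator_mem hX hinv fun t ht x hx ↦ ?_
        refine Subgroup.subset_closure (Or.inr ?_)
        rcases ht with ht | ht
        · exact hCD _ _ le_rfl (hC n t (hF ht) x hx)
        · obtain ⟨j, hj, htj⟩ := Set.mem_iUnion₂.1 ht
          exact hCD _ (j + 1) (Nat.le_succ_of_le hj) (hC j t htj x hx)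
      have := sup_zpowers _ a ih
      rwa [Subgroup.zpowers_eq_closure, ← Subgroup.closure_union, Set.union_comm,
        ← Set.union_assoc, Set.singleton_union] at this
  have hend : ∀ k n, Group.nilpotencyClass G ≤ n + k → P (Subgroup.closure (D n)) := by
    intro k
    induction k with
    | zero =>
      intro n hn
      convert bot
      refine (Subgroup.closure_eq_bot_iff).2 (Set.iUnion₂_subset fun j hj a ha ↦ ?_)
      have := hClcs j ha
      rw [Subgroup.lowerCentralSeries_eq_bot_iff_nilpotencyClass_le.2 (le_trans hn hj)] at this
      simpa using this
    | succ k ih => exact fun n hn ↦ hstep n (ih (n + 1) (by omega))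
  have := hend _ 0 (Nat.le_add_left _ _)
  rwa [top_le_iff.1 (hX.symm.le.trans (Subgroup.closure_mono (hCD 0 0 le_rfl)))] at this

/-- If a is central modulo the center Z, the commutators of a with the finitely many generators are
central and torsion. A common exponent m makes a ^ m central, so G / Z again has torsion center;
induct on the class. -/
theorem Group.isOfFinOrder_of_center {G : Type*} [Group G] [Group.IsNilpotent G]
    [Group.FG G] (hZ : ∀ z ∈ Subgroup.center G, IsOfFinOrder z) (g : G) :
    IsOfFinOrder g := by
  refine Group.nilpotent_center_quotient_ind (P := fun G _ _ ↦ Group.FG G →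
    (∀ z ∈ Subgroup.center G, IsOfFinOrder z) → ∀ g : G, IsOfFinOrder g) G ?_ ?_ ‹_› hZ g
  · intro G _ _ _ _ g
    rw [Subsingleton.elim g 1]
    exact IsOfFinOrder.one
  · intro G _ _ ih hfg hZ g
    obtain ⟨S, hS, hSfin⟩ := Group.fg_iff.1 hfg
    have hQ : ∀ z ∈ Subgroup.center (G ⧸ Subgroup.center G), IsOfFinOrder z := by
      intro z hz
      obtain ⟨a, rfl⟩ := QuotientGroup.mk_surjective z
      have hcomm : ∀ x : G, ⁅x, a⁆ ∈ Subgroup.center G := fun x ↦ by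
        rw [← QuotientGroup.eq_one_iff]
        have := Subgroup.mem_center_iff.1 hz (x : G ⧸ Subgroup.center G)
        rw [commutatorElement_def]
        rw [QuotientGroup.mk_mul, QuotientGroup.mk_mul, QuotientGroup.mk_mul, this,
          QuotientGroup.mk_inv, QuotientGroup.mk_inv]
        group
      have hn : ∀ x : G, ∃ n : ℕ, 0 < n ∧ ⁅x, a⁆ ^ n = 1 := fun x ↦
        isOfFinOrder_iff_pow_eq_one.1 (hZ _ (hcomm x))
      choose n hn0 hn using hn
      set m := ∏ x ∈ hSfin.toFinset, n x with hm
      have hmcomm : ∀ x ∈ S, x * a ^ m * x⁻¹ = a ^ m := by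
        intro x hx
        obtain ⟨k, hk⟩ := Finset.dvd_prod_of_mem n (hSfin.mem_toFinset.2 hx)
        have hx1 : ⁅x, a⁆ ^ m = 1 := by rw [hm, hk, pow_mul, hn, one_pow]
        have hx2 : x * a * x⁻¹ = ⁅x, a⁆ * a := by rw [commutatorElement_def]; group
        have hx3 : Commute ⁅x, a⁆ a := (Subgroup.mem_center_iff.1 (hcomm x) a).symm
        rw [← conj_pow, hx2, hx3.mul_pow, hx1, one_mul]
      refine isOfFinOrder_iff_pow_eq_one.2 ⟨m, Finset.prod_pos fun x _ ↦ hn0 x, ?_⟩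
      rw [← QuotientGroup.mk_pow, QuotientGroup.eq_one_iff, Subgroup.mem_center_iff]
      have hle : Subgroup.closure S ≤ Subgroup.centralizer {a ^ m} := by
        refine (Subgroup.closure_le _).2 fun x hx ↦ ?_
        rw [SetLike.mem_coe, Subgroup.mem_centralizer_singleton_iff]
        exact mul_inv_eq_iff_eq_mul.1 (hmcomm x hx)
      intro y
      exact Subgroup.mem_centralizer_singleton_iff.1 (hle (hS ▸ Subgroup.mem_top y))
    obtain ⟨n, hn0, hn⟩ := isOfFinOrder_iff_pow_eq_one.1 (ih inferInstance hQ (g : G ⧸ Subgroup.center G))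
    rw [← QuotientGroup.mk_pow, QuotientGroup.eq_one_iff] at hn
    exact (hZ _ hn).of_pow hn0.ne'

/-- A finitely generated nilpotent group with torsion center is finite. -/
theorem Group.finite_of_center {G : Type*} [Group G] [Group.IsNilpotent G] [Group.FG G]
    (hZ : ∀ z ∈ Subgroup.center G, IsOfFinOrder z) : Finite G := by
  have key : Finite (⊤ : Subgroup G) := by
    refine Group.fg_nilpotent_induction (P := fun H ↦ Finite H) inferInstance fun H _ g hH ↦ ?_
    have h1 : (H : Set G).Finite := hH
    have h2 : (Subgroup.zpowers g : Set G).Finite :=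
      finite_zpowers.2 (Group.isOfFinOrder_of_center hZ g)
    have := h1.mul h2
    rwa [← Subgroup.normal_mul] at this
  exact Finite.of_equiv _ Subgroup.topEquiv.toEquiv

end NilpotentGroups

/-! ### Irreducible modules over finitely generated nilpotent groups. -/

section IrreducibleModules

theorem Algebra.conj_mem_adjoin {J E : Type*} [CommRing J] [Ring E] [Algebra J E] {u v : E}
    (huv : u * v = 1) (hvu : v * u = 1) {s : Set E} {S : Subalgebra J E}
    (hs : ∀ t ∈ s, u * t * v ∈ S) {r : E} (hr : r ∈ Algebra.adjoin J s) : u * r * v ∈ S := by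
  induction hr using Algebra.adjoin_induction with
  | mem t ht => exact hs t ht
  | algebraMap c => rw [← Algebra.commutes, mul_assoc, huv, mul_one]; exact S.algebraMap_mem c
  | add a b _ _ ha hb => rw [mul_add, add_mul]; exact add_mem ha hb
  | mul a b _ _ ha hb =>
    have : u * (a * b) * v = u * a * v * (u * b * v) := by
      rw [mul_assoc (u * a) v, ← mul_assoc v, ← mul_assoc v, hvu, one_mul]
      simp only [mul_assoc]
    rw [this]
    exact mul_mem ha hb

theorem Subalgebra.NormalizedBy.of_conj {J E : Type*} [CommRing J] [Ring E] [Algebra J E]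
    {R : Subalgebra J E} {u v : E} (huv : u * v = 1) (hvu : v * u = 1)
    (h₁ : ∀ r ∈ R, u * r * v ∈ R) (h₂ : ∀ r ∈ R, v * r * u ∈ R) : R.NormalizedBy u where
  mul_left r hr := ⟨_, h₁ r hr, by rw [mul_assoc _ v, hvu, mul_one]⟩
  mul_right r hr := ⟨_, h₂ r hr, by rw [← mul_assoc, ← mul_assoc, huv, one_mul]⟩

theorem isGenericallyNondivisible_adjoin_range {J E V G : Type*} [CommRing J] [IsDomain J]
    [IsNoetherianRing J] [Ring E] [Algebra J E] [AddCommGroup V] [Module J V] [Module E V]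
    [IsScalarTower J E V] [Group G] [Group.FG G] [Group.IsNilpotent G] (ρ : G →* E) :
    IsGenericallyNondivisible V (Algebra.adjoin J (Set.range ρ)) := by
  have key := Group.fg_nilpotent_induction (G := G)
    (P := fun H ↦ IsGenericallyNondivisible V (Algebra.adjoin J (ρ '' (H : Set G)))) ?_ ?_
  · simpa using key
  · have : Algebra.adjoin J (ρ '' ((⊥ : Subgroup G) : Set G)) = ⊥ := by simp
    rw [this]
    exact isGenericallyNondivisible_bot
  · intro H hH g hgood
    set R := Algebra.adjoin J (ρ '' (H : Set G)) with hR
    have hinv : ∀ k : G, ρ k * ρ k⁻¹ = 1 := fun k ↦ by rw [← map_mul, mul_inv_cancel, map_one]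
    have hinv' : ∀ k : G, ρ k⁻¹ * ρ k = 1 := fun k ↦ by rw [← map_mul, inv_mul_cancel, map_one]
    have hconj : ∀ k : G, ∀ r ∈ R, ρ k * r * ρ k⁻¹ ∈ R := fun k r hr ↦ by
      refine Algebra.conj_mem_adjoin (hinv k) (hinv' k) ?_ hr
      rintro _ ⟨t, ht, rfl⟩
      rw [← map_mul, ← map_mul]
      exact Algebra.subset_adjoin ⟨_, hH.conj_mem t ht k, rfl⟩
    have hconj' : ∀ r ∈ R, ρ g⁻¹ * r * ρ g ∈ R := fun r hr ↦ by simpa using hconj g⁻¹ r hr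
    set R₁ := Algebra.adjoin J (insert (ρ g) (R : Set E)) with hR₁
    have hRR₁ : R ≤ R₁ := fun r hr ↦ Algebra.subset_adjoin (Set.mem_insert_of_mem _ hr)
    have hg : ρ g ∈ R₁ := Algebra.subset_adjoin (Set.mem_insert _ _)
    have hgood₁ : IsGenericallyNondivisible V R₁ :=
      hgood.adjoin_insert (.of_conj (hinv g) (hinv' g) (hconj g) hconj')
    -- The filtration uses only nonnegative powers, so the inverse is adjoined separately.
    have hgood₂ := hgood₁.adjoin_insert (x := ρ g⁻¹) <| by
      refine .of_conj (hinv' g) (hinv g) (fun r hr ↦ ?_) (fun r hr ↦ ?_)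
      · refine Algebra.conj_mem_adjoin (hinv' g) (hinv g) ?_ hr
        rintro t (rfl | ht)
        · rw [hinv', one_mul]; exact hg
        · exact hRR₁ (hconj' t ht)
      · refine Algebra.conj_mem_adjoin (hinv g) (hinv' g) ?_ hr
        rintro t (rfl | ht)
        · rw [mul_assoc, hinv, mul_one]; exact hg
        · exact hRR₁ (hconj g t ht)
    convert hgood₂ using 1
    set R₂ := Algebra.adjoin J (insert (ρ g⁻¹) (R₁ : Set E)) with hR₂
    have hR₁R₂ : R₁ ≤ R₂ := fun r hr ↦ Algebra.subset_adjoin (Set.mem_insert_of_mem _ hr)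
    set S := Algebra.adjoin J (ρ '' ((H ⊔ Subgroup.zpowers g : Subgroup G) : Set G)) with hS
    have hρS : ∀ k ∈ H ⊔ Subgroup.zpowers g, ρ k ∈ S := fun k hk ↦
      Algebra.subset_adjoin ⟨k, hk, rfl⟩
    have hgS : g ∈ H ⊔ Subgroup.zpowers g :=
      (le_sup_right : _ ≤ H ⊔ Subgroup.zpowers g) (Subgroup.mem_zpowers g)
    refine le_antisymm (Algebra.adjoin_le ?_) (Algebra.adjoin_le ?_)
    · let K : Subgroup G :=
        { carrier := {k | ρ k ∈ R₂ ∧ ρ k⁻¹ ∈ R₂}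
          one_mem' := by simp
          mul_mem' := fun {a b} ha hb ↦ ⟨by rw [map_mul]; exact mul_mem ha.1 hb.1, by
            rw [mul_inv_rev, map_mul]; exact mul_mem hb.2 ha.2⟩
          inv_mem' := fun {a} ha ↦ ⟨ha.2, by rw [inv_inv]; exact ha.1⟩ }
      have hHR : ∀ k ∈ H, ρ k ∈ R₂ := fun k hk ↦
        hR₁R₂ (hRR₁ (Algebra.subset_adjoin ⟨k, hk, rfl⟩))
      have hle : H ⊔ Subgroup.zpowers g ≤ K :=
        sup_le (fun k hk ↦ ⟨hHR k hk, hHR _ (inv_mem hk)⟩) (Subgroup.zpowers_le.2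
          ⟨hR₁R₂ hg, Algebra.subset_adjoin (Set.mem_insert _ _)⟩)
      rintro _ ⟨k, hk, rfl⟩
      exact (hle hk).1
    · refine Set.insert_subset (hρS _ (inv_mem hgS)) (Algebra.adjoin_le ?_)
      refine Set.insert_subset (hρS _ hgS) (Algebra.adjoin_mono (Set.image_mono ?_))
      exact fun k hk ↦ (le_sup_left : H ≤ H ⊔ Subgroup.zpowers g) hk

variable {G V : Type*} [Group G] [Group.FG G] [Group.IsNilpotent G] [AddCommGroup V]
  [DistribMulAction G V]

/-- A commutative noetherian domain with enough non-units cannot act faithfully, commuting with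
`G`, on an irreducible `G`-module when `G` is finitely generated nilpotent. -/
theorem exists_ne_zero_smul_eq_zero [Nontrivial V]
    (hirr : ∀ W : AddSubgroup V, (∀ g : G, ∀ w ∈ W, g • w ∈ W) → W = ⊥ ∨ W = ⊤)
    (J : Type*) [CommRing J] [IsDomain J] [IsNoetherianRing J] [Module J V] [SMulCommClass G J V]
    (hJ : ∀ f : J, f ≠ 0 → ∃ q : J, q ≠ 0 ∧ ¬ IsUnit q ∧ IsCoprime q f) :
    ∃ j : J, j ≠ 0 ∧ ∀ v : V, j • v = 0 := by
  by_contra! hcon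
  -- Schur: the kernel and the image of j are G-stable.
  have hinj : ∀ j : J, j ≠ 0 → ∀ v : V, j • v = 0 → v = 0 := by
    intro j hj v hv
    rcases hirr (DistribSMul.toAddMonoidHom V j).ker fun g w hw ↦ by
      change j • g • w = 0
      rw [← smul_comm, show j • w = 0 from hw, smul_zero] with h | h
    · have : v ∈ (DistribSMul.toAddMonoidHom V j).ker := hv
      rwa [h] at this
    · obtain ⟨w, hw⟩ := hcon j hj
      have : w ∈ (DistribSMul.toAddMonoidHom V j).ker := h ▸ AddSubgroup.mem_top w
      exact absurd this hw
  have hsurj : ∀ j : J, j ≠ 0 → ∀ v : V, ∃ w : V, j • w = v := by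
    intro j hj v
    rcases hirr (DistribSMul.toAddMonoidHom V j).range fun g w hw ↦ by
      obtain ⟨u, rfl⟩ := hw
      exact ⟨g • u, (smul_comm g j u).symm⟩ with h | h
    · obtain ⟨w, hw⟩ := hcon j hj
      have : j • w ∈ (DistribSMul.toAddMonoidHom V j).range := ⟨w, rfl⟩
      rw [h] at this
      exact absurd this hw
    · have : v ∈ (DistribSMul.toAddMonoidHom V j).range := h ▸ AddSubgroup.mem_top v
      exact this
  set R := Algebra.adjoin J (Set.range (DistribMulAction.toModuleEnd J V : G →* Module.End J V))
    with hR
  obtain ⟨v, hv⟩ := exists_ne (0 : V)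
  have hfg : (⊤ : Submodule R V).FG := by
    refine ⟨{v}, ?_⟩
    have hvmem : v ∈ Submodule.span R (({v} : Finset V) : Set V) :=
      Submodule.subset_span (by simp)
    rcases hirr (Submodule.span R (({v} : Finset V) : Set V)).toAddSubgroup fun g w hw ↦
      Submodule.smul_mem _ (⟨_, Algebra.subset_adjoin ⟨g, rfl⟩⟩ : R) hw with h | h
    · have : v ∈ (Submodule.span R (({v} : Finset V) : Set V)).toAddSubgroup := hvmem
      rw [h] at this
      exact absurd this hv
    · rwa [← Submodule.toAddSubgroup_inj]
  obtain ⟨f, hf0, hf⟩ := (isGenericallyNondivisible_adjoin_range _ ⊤ hfg).2 ⊥ bot_le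
  obtain ⟨q, hq0, hqu, hqf⟩ := hJ f hf0
  obtain ⟨k, hk⟩ := (hf q hq0 hqu hqf).2 (fun b _ ↦ by
    obtain ⟨w, rfl⟩ := hsurj q hq0 b
    exact ⟨w, trivial, by simp⟩) v trivial
  exact hv (hinj _ (pow_ne_zero k hf0) v (by simpa using hk))

theorem exists_prime_smul_eq_zero [Nontrivial V]
    (hirr : ∀ W : AddSubgroup V, (∀ g : G, ∀ w ∈ W, g • w ∈ W) → W = ⊥ ∨ W = ⊤) :
    ∃ p : ℕ, p.Prime ∧ ∀ v : V, p • v = 0 := by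
  obtain ⟨n, hn0, hn⟩ := exists_ne_zero_smul_eq_zero hirr ℤ fun f hf ↦ by
    -- The factor 2 and the square give q ≥ 3, hence a non-unit, whatever the sign of f.
    refine ⟨1 + 2 * f * f, ?_, ?_, ⟨1, - (2 * f), by ring⟩⟩
    · nlinarith [mul_self_nonneg f]
    · rw [Int.isUnit_iff]
      have : 0 < f * f := mul_self_pos.2 hf
      rintro (h | h) <;> nlinarith
  have hexp : AddMonoid.exponent V ≠ 0 := AddMonoid.exponent_ne_zero.2
    ⟨n.natAbs, Int.natAbs_pos.2 hn0, fun v ↦ by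
      rcases Int.natAbs_eq n with h | h
      · have := hn v
        rwa [h, natCast_zsmul] at this
      · have := hn v
        rwa [h, neg_smul, natCast_zsmul, neg_eq_zero] at this⟩
  have hexp1 : AddMonoid.exponent V ≠ 1 := fun h ↦
    not_subsingleton V (AddMonoid.exp_eq_one_iff.1 h)
  set p := (AddMonoid.exponent V).minFac with hp
  have hpp : p.Prime := Nat.minFac_prime hexp1
  refine ⟨p, hpp, fun v ↦ ?_⟩
  obtain ⟨k, hk⟩ := Nat.minFac_dvd (AddMonoid.exponent V)
  rcases hirr (nsmulAddMonoidHom p : V →+ V).ker fun g w hw ↦ by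
    change p • g • w = 0
    rw [← smul_comm, show p • w = 0 from hw, smul_zero] with h | h
  -- If p acted injectively, exponent / p would already kill V.
  · have hkV : ∀ w : V, k • w = 0 := fun w ↦ by
      have : k • w ∈ (nsmulAddMonoidHom p : V →+ V).ker := by
        change p • k • w = 0
        rw [← mul_smul, ← hk, AddMonoid.exponent_nsmul_eq_zero]
      rwa [h] at this
    have hk0 : 0 < k := Nat.pos_of_ne_zero fun h0 ↦ hexp (by rw [hk, h0, mul_zero])
    have := Nat.le_of_dvd hk0 (AddMonoid.exponent_dvd_of_forall_nsmul_eq_zero hkV)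
    rw [hk] at this
    nlinarith [hpp.two_le]
  · have : v ∈ (nsmulAddMonoidHom p : V →+ V).ker := h ▸ AddSubgroup.mem_top v
    exact this

/-- Let X act as z. Some j ≠ 0 in K[X] kills V, and K[X]/(j) is finite, so two powers of X agree on
V. -/
theorem exists_pow_smul_eq_of_mem_center_of_finite_field [Nontrivial V]
    (hirr : ∀ W : AddSubgroup V, (∀ g : G, ∀ w ∈ W, g • w ∈ W) → W = ⊥ ∨ W = ⊤)
    (K : Type*) [Field K] [Finite K] [Module K V] [SMulCommClass G K V]
    {z : G} (hz : z ∈ Subgroup.center G) : ∃ n : ℕ, 0 < n ∧ ∀ v : V, z ^ n • v = v := by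
  let φ : Module.End K V := DistribMulAction.toModuleEnd K V z
  let α : Polynomial K →ₐ[K] Module.End K V := Polynomial.aeval φ
  let : Module (Polynomial K) V := Module.compHom V (α : _ →+* Module.End K V)
  have hsmul : ∀ (f : Polynomial K) (v : V), f • v = Polynomial.aeval φ f v :=
    fun _ _ ↦ rfl
  have hpow : ∀ (n : ℕ) (v : V), (φ ^ n) v = z ^ n • v := fun n v ↦ by
    rw [← map_pow]
    rfl
  have : SMulCommClass G (Polynomial K) V := ⟨fun g f v ↦ by
    simp only [hsmul]
    have hg : Commute (DistribMulAction.toModuleEnd K V g) φ := by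
      change _ * _ = _ * _
      rw [← map_mul, ← map_mul, Subgroup.mem_center_iff.1 hz g]
    have hgf : Commute (DistribMulAction.toModuleEnd K V g) (Polynomial.aeval φ f) := by
      induction f using Polynomial.induction_on' with
      | add f₁ f₂ h₁ h₂ => rw [map_add]; exact h₁.add_right h₂
      | monomial n c =>
        rw [Polynomial.aeval_monomial]
        exact (Algebra.commute_algebraMap_right c _).mul_right (hg.pow_right n)
    exact LinearMap.congr_fun hgf v⟩
  obtain ⟨j, hj0, hj⟩ := exists_ne_zero_smul_eq_zero hirr (Polynomial K) fun f hf ↦ by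
    have hdeg : (1 + Polynomial.X * f).natDegree ≠ 0 := by
      rw [add_comm, ← Polynomial.C_1, Polynomial.natDegree_add_C, Polynomial.natDegree_X_mul hf]
      exact Nat.succ_ne_zero _
    refine ⟨1 + Polynomial.X * f, ?_, ?_, ⟨1, - Polynomial.X, by ring⟩⟩
    · intro h
      simp [h] at hdeg
    · exact fun h ↦ hdeg (Polynomial.natDegree_eq_zero_of_isUnit h)
  have : Module.Finite K (AdjoinRoot j) := (AdjoinRoot.powerBasis hj0).finite
  have : Finite (AdjoinRoot j) := Module.finite_of_finite K
  obtain ⟨a, b, hab, h⟩ := Finite.exists_ne_map_eq_of_infinite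
    fun n : ℕ ↦ AdjoinRoot.mk j (Polynomial.X ^ n)
  wlog hlt : a < b generalizing a b
  · exact this b a hab.symm h.symm (lt_of_le_of_ne (not_lt.1 hlt) hab.symm)
  obtain ⟨c, hc⟩ := AdjoinRoot.mk_eq_mk.1 h
  refine ⟨b - a, Nat.sub_pos_of_lt hlt, fun v ↦ ?_⟩
  have h1 : ∀ w : V, z ^ a • w = z ^ b • w := fun w ↦ by
    have : (Polynomial.X ^ a - Polynomial.X ^ b : Polynomial K) • w = 0 := by
      rw [hc, mul_smul, hj]
    rw [hsmul] at this
    rwa [map_sub, map_pow, map_pow, Polynomial.aeval_X, LinearMap.sub_apply, hpow, hpow,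
      sub_eq_zero] at this
  have h2 := h1 v
  rw [← Nat.sub_add_cancel hlt.le, Nat.add_comm, pow_add, mul_smul] at h2
  exact (smul_left_cancel _ h2).symm

theorem exists_pow_smul_eq_of_mem_center [Nontrivial V]
    (hirr : ∀ W : AddSubgroup V, (∀ g : G, ∀ w ∈ W, g • w ∈ W) → W = ⊥ ∨ W = ⊤)
    {z : G} (hz : z ∈ Subgroup.center G) : ∃ n : ℕ, 0 < n ∧ ∀ v : V, z ^ n • v = v := by
  obtain ⟨p, hp, hpV⟩ := exists_prime_smul_eq_zero hirr
  have : Fact p.Prime := ⟨hp⟩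
  let : Module (ZMod p) V := AddCommGroup.zmodModule hpV
  have hcomm : ∀ (g : G) (c : ZMod p) (v : V), g • c • v = c • g • v := fun g c v ↦
    ZMod.map_smul (DistribSMul.toAddMonoidHom V g) c v
  have : SMulCommClass G (ZMod p) V := ⟨hcomm⟩
  exact exists_pow_smul_eq_of_mem_center_of_finite_field hirr (ZMod p) hz

/-- A finitely generated nilpotent group acts on an irreducible module through a finite group. -/
theorem finite_range_toPermHom [Nontrivial V]
    (hirr : ∀ W : AddSubgroup V, (∀ g : G, ∀ w ∈ W, g • w ∈ W) → W = ⊥ ∨ W = ⊤) :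
    Finite (MulAction.toPermHom G V).range := by
  set H := (MulAction.toPermHom G V).range with hH
  have hsurj := (MulAction.toPermHom G V).rangeRestrict_surjective
  have : Group.IsNilpotent H := Group.nilpotent_of_surjective _ hsurj
  have : Group.FG H := Group.fg_of_surjective hsurj
  let : DistribMulAction H V :=
    { smul_zero := by rintro ⟨_, g, rfl⟩; exact smul_zero g
      smul_add := by rintro ⟨_, g, rfl⟩; exact smul_add g }
  have hirrH : ∀ W : AddSubgroup V, (∀ g : H, ∀ w ∈ W, g • w ∈ W) → W = ⊥ ∨ W = ⊤ :=
    fun W hW ↦ hirr W fun g w hw ↦ hW ⟨_, g, rfl⟩ w hw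
  -- The image acts faithfully, so a power of z fixing V pointwise is 1.
  refine Group.finite_of_center fun z hz ↦ ?_
  obtain ⟨n, hn0, hn⟩ := exists_pow_smul_eq_of_mem_center hirrH hz
  refine isOfFinOrder_iff_pow_eq_one.2 ⟨n, hn0, Subtype.ext (Equiv.ext fun v ↦ ?_)⟩
  exact hn v

end IrreducibleModules

/-! ### Finitely full left ideals are everything. -/

theorem mainTheorem7 (G : Type*) [Group G] [Group.FG G] [Group.IsNilpotent G] :
    HasFinitelyDetectableFullLeftIdeals G := by
  intro I hI
  by_contra hne
  obtain ⟨M, hM, hIM⟩ := Ideal.exists_le_maximal I hne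
  let V := MonoidAlgebra ℤ G ⧸ (M : Submodule (MonoidAlgebra ℤ G) (MonoidAlgebra ℤ G))
  have hsimple : IsSimpleModule (MonoidAlgebra ℤ G) V := isSimpleModule_iff_isCoatom.2 hM.out
  have : Nontrivial V := IsSimpleModule.nontrivial (MonoidAlgebra ℤ G) V
  let : DistribMulAction G V := DistribMulAction.compHom V (MonoidAlgebra.of ℤ G)
  have hirr : ∀ W : AddSubgroup V, (∀ g : G, ∀ w ∈ W, g • w ∈ W) → W = ⊥ ∨ W = ⊤ := by
    intro W hW
    let W' : Submodule (MonoidAlgebra ℤ G) V :=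
      { W with
        smul_mem' := fun a w hw ↦ by
          induction a using MonoidAlgebra.induction_on with
          | of g => exact hW g w hw
          | add a b ha hb => rw [add_smul]; exact W.add_mem ha hb
          | smul n a ha => rw [smul_assoc]; exact W.zsmul_mem ha n }
    rcases eq_bot_or_eq_top W' with h | h
    · left
      ext w
      exact SetLike.ext_iff.1 h w
    · right
      ext w
      exact SetLike.ext_iff.1 h w
  have := finite_range_toPermHom hirr
  set H := (MulAction.toPermHom G V).ker with hH
  have hHfin : H.FiniteIndex := inferInstance
  obtain ⟨a, haI, ha⟩ : (1 : MonoidAlgebra ℤ (G ⧸ H)) ∈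
      groupRingProj H '' (I : Set (MonoidAlgebra ℤ G)) := hI H hHfin ▸ Set.mem_univ _
  -- H acts trivially, so the action of ℤ[G] on V factors through ℤ[G/H].
  let θ : MonoidAlgebra ℤ (G ⧸ H) →ₐ[ℤ] Module.End ℤ V := MonoidAlgebra.lift ℤ _ _
    (QuotientGroup.lift H (DistribMulAction.toModuleEnd ℤ V) fun g hg ↦
      LinearMap.ext fun v ↦ Equiv.congr_fun (MonoidHom.mem_ker.1 hg) v)
  have hθ : ∀ (b : MonoidAlgebra ℤ G) (v : V), θ (groupRingProj H b) v = b • v := by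
    intro b v
    induction b using MonoidAlgebra.induction_on with
    | of g =>
      have hg : groupRingProj H (MonoidAlgebra.of ℤ G g) = MonoidAlgebra.of ℤ (G ⧸ H) g := by
        simp [groupRingProj]
      rw [hg, MonoidAlgebra.lift_of]
      rfl
    | add a b ha hb => rw [map_add, map_add, LinearMap.add_apply, ha, hb, add_smul]
    | smul n a ha => rw [map_zsmul, map_zsmul, LinearMap.smul_apply, ha, smul_assoc]
  have h1 := hθ a (Submodule.Quotient.mk 1)
  rw [ha, map_one, Module.End.one_apply, ← Submodule.Quotient.mk_smul, smul_eq_mul, mul_one,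
    (Submodule.Quotient.mk_eq_zero _).2 (hIM haI), Submodule.Quotient.mk_eq_zero] at h1
  exact hM.ne_top ((Ideal.eq_top_iff_one M).2 h1)
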